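/- Let $C=\{0,1\}^{\mathbb N}$ (where $\mathbb N=\{1,2,3,\dots\}$) be the Cantor space with the metric $d(\sigma,\sigma)=0$ and, for $\sigma\neq\tau$, $d(\sigma,\tau)=1/n$, where $n$ is the least positive integer such that $\sigma(n)\neq\tau(n)$. Let $\mathcal H(C)$ be the Baire space of all homeomorphisms of $C$ onto $C$ with the metric $\tilde d(f,g)=\max_{x\in C}d(f(x),g(x))$. Let $\mathcal M(C)$ be the space of all Borel probability measures on $C$ with the Prohorov metric $$d_P(\mu,\nu)=\inf\{\delta>0:\ \mu(X)\le\nu(X^\delta)+\delta \text{ and } \nu(X)\le\mu(X^\delta)+\delta \text{ for all Borel sets } X\subset C\},$$ where $X^\delta=\{x\in C: d(x,y)<\delta \text{ for some } y\in X\}$. For $h\in\mathcal H(C)$ let $\tilde h:\mathcal M(C)\to\mathcal M(C)$ be the induced map $(\tilde h(\mu))(X)=\mu(h^{-1}(X))$. A pair $(\mu,\nu)\in\mathcal M(C)\times\mathcal M(C)$ is a Li-Yorke pair for $\tilde h$ if $$\liminf_{n\to\infty}d_P(\tilde h^n(\mu),\tilde h^n(\nu))=0\quad\text{and}\quad\limsup_{n\to\infty}d_P(\tilde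 h^n(\mu),\tilde h^n(\nu))>0.$$ **Theorem.** For the generic $h\in\mathcal H(C)$, the map $\tilde h$ has no Li-Yorke pair; that is, the set of all $h\in\mathcal H(C)$ for which $\tilde h$ has a Li-Yorke pair is of the first category in $\mathcal H(C)$. -/

import Mathlib

open MeasureTheory Filter Topology

noncomputable section

namespace CantorDynamics

/-! ### The Cantor space `{0,1}^ℕ` and its metric -/

/-- The Cantor space: all sequences of zeros and ones.  The `n`-th term (`n = 1, 2, …`) of a
sequence is its value at the index `n - 1`. -/
def Cantor : Type := ℕ → Bool

namespace Cantor

instance : Nonempty Cantor := inferInstanceAs (Nonempty (ℕ → Bool))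

/-- The product topology of the discrete topologies. -/
instance : TopologicalSpace Cantor := inferInstanceAs (TopologicalSpace (ℕ → Bool))

instance : CompactSpace Cantor := inferInstanceAs (CompactSpace (ℕ → Bool))

open Classical in
/-- `d(σ, σ) = 0`, and `d(σ, τ) = 1 / n` when `σ ≠ τ` and the `n`-th terms are the first ones
in which `σ` and `τ` differ.  (Terms are indexed from `0` in the code, hence the `+ 1`.) -/
def distance (σ τ : Cantor) : ℝ :=
  if h : ∃ k, σ k ≠ τ k then 1 / ((Nat.find h : ℝ) + 1) else 0

theorem distance_self (σ : Cantor) : distance σ σ = 0 := by simp [distance]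

theorem distance_comm (σ τ : Cantor) : distance σ τ = distance τ σ := by
  classical
  unfold distance
  by_cases h : ∃ k, σ k ≠ τ k
  · have h' : ∃ k, τ k ≠ σ k := h.imp fun _ => Ne.symm
    have he : Nat.find h = Nat.find h' := Nat.find_congr' ne_comm
    rw [dif_pos h, dif_pos h', he]
  · rw [dif_neg h, dif_neg fun h' => h (h'.imp fun _ => Ne.symm)]

theorem distance_nonneg (σ τ : Cantor) : 0 ≤ distance σ τ := by
  unfold distance
  split_ifs
  · positivity
  · exact le_rfl

/-- Two sequences are at distance `< 1 / n` iff their first `n` terms agree. -/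
theorem distance_lt_iff (σ τ : Cantor) (n : ℕ) :
    distance σ τ < 1 / ((n : ℝ) + 1) ↔ ∀ k ≤ n, σ k = τ k := by
  classical
  unfold distance
  split_ifs with h
  · rw [one_div_lt_one_div (by positivity) (by positivity), add_lt_add_iff_right, Nat.cast_lt,
      Nat.lt_find_iff]
    simp
  · push Not at h
    simp only [h, implies_true, iff_true]
    positivity

theorem distance_triangle (σ τ υ : Cantor) :
    distance σ υ ≤ distance σ τ + distance τ υ := by
  by_cases h : ∃ k, σ k ≠ υ k
  · classical
    have hd : distance σ υ = 1 / ((Nat.find h : ℝ) + 1) := by simp only [distance, dif_pos h]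
    by_contra! hlt
    have h1 := (distance_lt_iff σ τ (Nat.find h)).1
      (by linarith [distance_nonneg τ υ]) _ le_rfl
    have h2 := (distance_lt_iff τ υ (Nat.find h)).1
      (by linarith [distance_nonneg σ τ]) _ le_rfl
    exact Nat.find_spec h (h1.trans h2)
  · rw [distance, dif_neg h]
    exact add_nonneg (distance_nonneg _ _) (distance_nonneg _ _)

theorem eq_of_distance_eq_zero (σ τ : Cantor) (h : distance σ τ = 0) : σ = τ :=
  funext fun k => (distance_lt_iff σ τ k).1 (by rw [h]; positivity) k le_rfl

theorem isOpen_iff_distance (s : Set Cantor) :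
    IsOpen s ↔ ∀ σ ∈ s, ∃ ε > 0, ∀ τ, distance σ τ < ε → τ ∈ s := by
  have hb := PiNat.isTopologicalBasis_cylinders (fun _ : ℕ => Bool)
  constructor
  · intro hs σ hσ
    obtain ⟨v, ⟨y, n, rfl⟩, h1, h2⟩ := hb.exists_subset_of_mem_open hσ hs
    refine ⟨1 / ((n : ℝ) + 1), by positivity, fun τ hτ => h2 fun i hi => ?_⟩
    rw [← (distance_lt_iff σ τ n).1 hτ i hi.le]
    exact h1 i hi
  · intro h
    refine hb.isOpen_iff.2 fun σ hσ => ?_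
    obtain ⟨ε, hε, hs⟩ := h σ hσ
    obtain ⟨n, hn⟩ := exists_nat_one_div_lt hε
    refine ⟨PiNat.cylinder σ (n + 1), ⟨σ, n + 1, rfl⟩, PiNat.self_mem_cylinder _ _,
      fun τ hτ => hs τ (lt_trans ?_ hn)⟩
    exact (distance_lt_iff σ τ n).2 fun k hk => (hτ k (Nat.lt_succ_of_le hk)).symm

/-- The metric `distance`; it induces the product topology. -/
instance : MetricSpace Cantor :=
  MetricSpace.ofDistTopology distance distance_self distance_comm distance_triangle
    isOpen_iff_distance eq_of_distance_eq_zero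

/-- The Borel `σ`-algebra. -/
instance : MeasurableSpace Cantor := borel Cantor

instance : BorelSpace Cantor := ⟨rfl⟩

end Cantor

/-! ### The space of homeomorphisms of a compact metric space -/

section Homeo

variable {M : Type*} [MetricSpace M] [CompactSpace M]

/-- The homeomorphisms of `M` onto `M`, with the metric of uniform convergence that they inherit
from the space `C(M, M)` of continuous maps. -/
instance homeoMetricSpace : MetricSpace (M ≃ₜ M) :=
  MetricSpace.induced (fun h => (h : C(M, M)))
    (fun _ _ hfg => Homeomorph.ext fun x => DFunLike.congr_fun hfg x) inferInstance

/-- `d̃(f, g) = max_{x ∈ M} d(f(x), g(x))`. -/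
theorem isGreatest_dist_homeo [Nonempty M] (f g : M ≃ₜ M) :
    IsGreatest (Set.range fun x => dist (f x) (g x)) (dist f g) := by
  have hd : dist f g = ⨆ x, dist (f x) (g x) :=
    ContinuousMap.dist_eq_iSup (f := (f : C(M, M))) (g := (g : C(M, M)))
  have hc : Continuous fun x => dist (f x) (g x) := f.continuous.dist g.continuous
  obtain ⟨x, hx⟩ := (isCompact_range hc).exists_isGreatest (Set.range_nonempty _)
  rw [hd, iSup, hx.csSup_eq]
  exact hx

theorem continuous_coe_homeo : Continuous fun h : M ≃ₜ M => (h : C(M, M)) :=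
  continuous_induced_dom

theorem continuous_symm_homeo : Continuous fun h : M ≃ₜ M => h.symm := by
  rw [Metric.continuous_iff]
  intro f ε hε
  have huc := CompactSpace.uniformContinuous_of_continuous f.symm.continuous
  obtain ⟨δ, hδ, hf⟩ := Metric.uniformContinuous_iff.1 huc (ε / 2) (half_pos hε)
  refine ⟨δ, hδ, fun g hg => ?_⟩
  have hgf : ∀ x, dist (g x) (f x) < δ := fun x =>
    lt_of_le_of_lt (ContinuousMap.dist_apply_le_dist (f := (g : C(M, M))) (g := (f : C(M, M))) x) hg
  refine lt_of_le_of_lt ((ContinuousMap.dist_le (f := (g.symm : C(M, M)))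
    (g := (f.symm : C(M, M))) (half_pos hε).le).2 fun y => ?_) (half_lt_self hε)
  have h1 := hf (hgf (g.symm y))
  rw [Homeomorph.apply_symm_apply, Homeomorph.symm_apply_apply, dist_comm] at h1
  exact h1.le

/-- The space of homeomorphisms of a compact metric space is a Baire space. -/
instance homeo_baireSpace : BaireSpace (M ≃ₜ M) := by
  have he : IsClosedEmbedding
      fun h : M ≃ₜ M => ((h : C(M, M)), (h.symm : C(M, M))) := by
    refine ⟨⟨⟨?_⟩, fun f g hfg => Homeomorph.ext fun x =>
      DFunLike.congr_fun (congrArg Prod.fst hfg) x⟩, ?_⟩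
    · apply le_antisymm
      · exact continuous_iff_le_induced.1
          (continuous_coe_homeo.prodMk (continuous_coe_homeo.comp continuous_symm_homeo))
      · rw [instTopologicalSpaceProd, induced_inf, induced_compose]
        exact inf_le_left
    · have hr : (Set.range fun h : M ≃ₜ M => ((h : C(M, M)), (h.symm : C(M, M)))) =
          {p : C(M, M) × C(M, M) | p.1.comp p.2 = ContinuousMap.id M} ∩
            {p : C(M, M) × C(M, M) | p.2.comp p.1 = ContinuousMap.id M} := by
        ext ⟨a, b⟩
        constructor
        · rintro ⟨h, hh⟩
          cases hh
          exact ⟨by ext; simp, by ext; simp⟩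
        · rintro ⟨h1, h2⟩
          exact ⟨⟨⟨a, b, DFunLike.congr_fun h2, DFunLike.congr_fun h1⟩, a.continuous,
            b.continuous⟩, rfl⟩
      rw [hr]
      exact (isClosed_eq (continuous_fst.compCM continuous_snd) continuous_const).inter
        (isClosed_eq (continuous_snd.compCM continuous_fst) continuous_const)
  have := he.IsCompletelyMetrizableSpace
  infer_instance

end Homeo

/-- The generic element of the Baire space `Z` has the property `P`: the set of all elements that
do not satisfy `P` is of the first category (meagre). -/
def Generic (Z : Type*) [TopologicalSpace Z] [BaireSpace Z] (P : Z → Prop) : Prop :=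
  IsMeagre {z : Z | ¬ P z}

/-! ### The space of Borel probability measures and the induced map -/

section Measures

variable (M : Type*) [MetricSpace M] [MeasurableSpace M] [BorelSpace M]

/-- The space of Borel probability measures on `M` with the (Lévy–)Prohorov metric. -/
abbrev ProbMeas : Type _ := LevyProkhorov (ProbabilityMeasure M)

variable {M} [CompactSpace M]

instance : CompactSpace (ProbMeas M) :=
  (LevyProkhorov.probabilityMeasureHomeomorph (Ω := M)).compactSpace

/-- The map `μ ↦ μ ∘ f⁻¹` on Borel probability measures that a continuous map `f : M → M`
induces. -/
def inducedMap (f : C(M, M)) : C(ProbMeas M, ProbMeas M) where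
  toFun μ := LevyProkhorov.ofMeasure (μ.toMeasure.map f.continuous.measurable.aemeasurable)
  continuous_toFun :=
    LevyProkhorov.continuous_ofMeasure_probabilityMeasure.comp
      ((ProbabilityMeasure.continuous_map f.continuous).comp
        LevyProkhorov.continuous_toMeasure_probabilityMeasure)

/-- `(f̃ μ)(X) = μ(f⁻¹(X))` for Borel sets `X`. -/
theorem inducedMap_apply (f : C(M, M)) (μ : ProbMeas M) {X : Set M} (hX : MeasurableSet X) :
    (inducedMap f μ).toMeasure X = μ.toMeasure (f ⁻¹' X) :=
  ProbabilityMeasure.map_apply _ f.continuous.measurable.aemeasurable hX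

end Measures

/-! ### Li–Yorke pairs -/

/-- `(x, y)` is a Li–Yorke pair for the continuous map `f` of the compact metric space `X`.  The
distances are bounded because `X` is compact, so both limits are genuine real numbers. -/
def IsLiYorkePair {X : Type*} [MetricSpace X] [CompactSpace X] (f : C(X, X)) (x y : X) : Prop :=
  liminf (fun n : ℕ => dist (f^[n] x) (f^[n] y)) atTop = 0 ∧
    0 < limsup (fun n : ℕ => dist (f^[n] x) (f^[n] y)) atTop

end CantorDynamics

end

namespace CantorDynamics

/-! ### Homeomorphisms between finite multiples of the Cantor space -/

namespace Cantor

/-! For generic `h` and every `m` there is a period `q`, the same for all points, such that the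
first `m` terms of `h^[n] x` are eventually `q`-periodic in `n`; only the starting time depends on
`x`. Given `μ`, that time is bounded by some `N` off a set of small `μ`-measure, so from `N` on the
masses that the iterates of `μ` give to unions of `m`-cylinders are `q`-periodic up to a small
error. These masses control the Prohorov distance. If two orbits of measures come very close at one
late time, continuity keeps them close for the next `q` steps, and approximate periodicity keeps
them close forever. Hence liminf zero forces the distance to tend to zero.

Genericity comes from approximating `h` by a homeomorphism whose transitions follow a finite
digraph, an open condition. The digraph needs edges out of and into every vertex, yet all its walks
must be eventually periodic with a common period; `TwoPhase` achieves both. -/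

theorem continuous_iff_apply {X : Type*} [TopologicalSpace X] {f : X → Cantor} :
    Continuous f ↔ ∀ n, Continuous fun x => f x n :=
  continuous_pi_iff (A := fun _ : ℕ => Bool)

theorem continuous_eval (n : ℕ) : Continuous fun x : Cantor => x n :=
  continuous_iff_apply.1 continuous_id n

/-- The first `m` terms of a sequence. -/
def initial (m : ℕ) (x : Cantor) : Fin m → Bool := fun i => x i

theorem continuous_initial (m : ℕ) : Continuous (initial m) :=
  continuous_pi fun i => continuous_eval i

theorem initial_eq_iff {m : ℕ} {x y : Cantor} :
    initial m x = initial m y ↔ ∀ k < m, x k = y k :=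
  ⟨fun h k hk => congrFun h ⟨k, hk⟩, fun h => funext fun i => h i i.2⟩

theorem initial_succ_eq_iff {m : ℕ} {x y : Cantor} :
    initial (m + 1) x = initial (m + 1) y ↔ dist x y < 1 / ((m : ℝ) + 1) := by
  rw [initial_eq_iff]
  simp only [Nat.lt_succ_iff]
  exact (distance_lt_iff x y m).symm

/-- Splitting a sequence into its first `m` terms and the others. -/
def appendEquiv (m : ℕ) : (Fin m → Bool) × Cantor ≃ Cantor where
  toFun p k := if hk : k < m then p.1 ⟨k, hk⟩ else p.2 (k - m)
  invFun x := (initial m x, fun k => x (k + m))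
  left_inv p := by
    refine Prod.ext (funext fun i => ?_) (funext fun k => ?_)
    · simp [initial]
    · simp
  right_inv x := by
    funext k
    by_cases hk : k < m
    · simp [hk, initial]
    · simp [hk, Nat.sub_add_cancel (not_lt.1 hk)]

theorem initial_appendEquiv (m : ℕ) (p : (Fin m → Bool) × Cantor) :
    initial m (appendEquiv m p) = p.1 :=
  congrArg Prod.fst ((appendEquiv m).left_inv p)

theorem continuous_appendEquiv (m : ℕ) : Continuous (appendEquiv m) := by
  refine continuous_iff_apply.2 fun k => ?_
  change Continuous fun p : (Fin m → Bool) × Cantor =>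
    if hk : k < m then p.1 ⟨k, hk⟩ else p.2 (k - m)
  split_ifs with hk
  · exact (continuous_apply _).comp continuous_fst
  · exact (continuous_eval (k - m)).comp continuous_snd

/-- Putting a term in front of a sequence. -/
def consEquiv : Bool × Cantor ≃ Cantor where
  toFun p k := Nat.casesOn k p.1 p.2
  invFun x := (x 0, fun k => x (k + 1))
  left_inv _ := rfl
  right_inv x := by
    funext k
    cases k <;> rfl

theorem continuous_consEquiv : Continuous consEquiv := by
  refine continuous_iff_apply.2 fun k => ?_
  cases k with
  | zero => exact continuous_fst
  | succ k => exact (continuous_eval k).comp continuous_snd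

/-- A nonempty finite sum of copies of the Cantor space is a Cantor space. -/
theorem exists_equiv_finite_prod (F : Type) [Finite F] :
    Nonempty F → ∃ e : F × Cantor ≃ Cantor, ∀ a, Continuous fun x => e (a, x) := by
  induction F using Finite.induction_empty_option with
  | of_equiv u ih =>
    intro hne
    obtain ⟨e, he⟩ := ih (u.nonempty_congr.2 hne)
    exact ⟨(u.symm.prodCongr (Equiv.refl _)).trans e, fun a => he (u.symm a)⟩
  | h_empty => exact fun h => h.elim fun a => a.elim
  | @h_option α _ ih =>
    intro _
    rcases isEmpty_or_nonempty α with hα | hα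
    · exact ⟨Equiv.uniqueProd Cantor (Option α), fun a => continuous_id⟩
    · obtain ⟨e, he⟩ := ih hα
      refine ⟨Equiv.trans
        { toFun := fun p => p.1.elim (false, p.2) fun a => (true, e (a, p.2))
          invFun := fun p =>
            bif p.1 then (some (e.symm p.2).1, (e.symm p.2).2) else (none, p.2)
          left_inv := ?_
          right_inv := ?_ } consEquiv, ?_⟩
      · rintro ⟨_ | a, x⟩ <;> simp
      · rintro ⟨_ | _, x⟩ <;> simp
      · rintro (_ | a)
        · exact continuous_consEquiv.comp (continuous_const.prodMk continuous_id)
        · exact continuous_consEquiv.comp (continuous_const.prodMk (he a))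

/-- A surjection between finite sets lifts to a homeomorphism between the corresponding sums of
copies of the Cantor space. -/
theorem exists_homeomorph_of_surjective {E D : Type} [Finite E] [Finite D]
    [TopologicalSpace E] [DiscreteTopology E] [TopologicalSpace D] [DiscreteTopology D]
    (f : E → D) (hf : Function.Surjective f) :
    ∃ Φ : E × Cantor ≃ₜ D × Cantor, ∀ p, (Φ p).1 = f p.1 := by
  have hne (d : D) : Nonempty {a : E // f a = d} :=
    let ⟨a, ha⟩ := hf d
    ⟨⟨a, ha⟩⟩
  choose θ hθ using fun d => exists_equiv_finite_prod {a : E // f a = d} (hne d)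
  -- Stated for separate `d` and `d'` so that `subst` can identify the two fibres.
  have hinj (d d' : D) (h : d = d') (a b : E) (ha : f a = d) (hb : f b = d') (x y : Cantor)
      (he : θ d (⟨a, ha⟩, x) = θ d' (⟨b, hb⟩, y)) : (a, x) = (b, y) := by
    subst h
    have := (θ d).injective he
    simpa using this
  let φ (p : E × Cantor) : D × Cantor := (f p.1, θ (f p.1) (⟨p.1, rfl⟩, p.2))
  have hφ : Function.Bijective φ := by
    refine ⟨fun p p' h => ?_, fun ⟨d, x⟩ => ?_⟩
    · exact hinj _ _ (congrArg Prod.fst h) _ _ rfl rfl _ _ (congrArg Prod.snd h)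
    · obtain ⟨⟨⟨a, rfl⟩, y⟩, rfl⟩ := (θ d).surjective x
      exact ⟨(a, y), rfl⟩
  have hΦ : Continuous (Equiv.ofBijective φ hφ) := continuous_prod_of_discrete_left.2 fun a =>
    (continuous_const (y := f a)).prodMk (hθ (f a) ⟨a, rfl⟩)
  exact ⟨hΦ.homeoOfEquivCompactToT2, fun _ => rfl⟩

/-- A finite digraph without sources and sinks, whose vertices carry labels that exhaust the
words of length `m`, is the transition graph of a homeomorphism of the Cantor space. -/
theorem exists_homeomorph_of_digraph {m : ℕ} {D : Type} [Finite D] [TopologicalSpace D]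
    [DiscreteTopology D] (π : D → Fin m → Bool) (hπ : Function.Surjective π)
    (R : D → D → Prop) (hout : ∀ d, ∃ d', R d d') (hin : ∀ d', ∃ d, R d d') :
    ∃ (κ : Cantor → D) (g : Cantor ≃ₜ Cantor), Continuous κ ∧
      (∀ x, initial m x = π (κ x)) ∧ ∀ x, R (κ x) (κ (g x)) := by
  obtain ⟨Φ, hΦ⟩ := exists_homeomorph_of_surjective π hπ
  -- The copies of the Cantor space indexed by edges are regrouped by source (`S`) and by target
  -- (`T`). Then `T ∘ S⁻¹`, read in the chart `K`, carries each point along an edge.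
  obtain ⟨S, hS⟩ := exists_homeomorph_of_surjective
    (fun a : {p : D × D // R p.1 p.2} => a.1.1) fun d => (hout d).elim fun d' h => ⟨⟨(d, d'), h⟩, rfl⟩
  obtain ⟨T, hT⟩ := exists_homeomorph_of_surjective
    (fun a : {p : D × D // R p.1 p.2} => a.1.2) fun d' => (hin d').elim fun d h => ⟨⟨(d, d'), h⟩, rfl⟩
  let Ψ : (Fin m → Bool) × Cantor ≃ₜ Cantor := (continuous_appendEquiv m).homeoOfEquivCompactToT2
  let K : D × Cantor ≃ₜ Cantor := Φ.trans Ψ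
  refine ⟨fun x => (K.symm x).1, K.symm.trans (S.symm.trans (T.trans K)),
    continuous_fst.comp K.symm.continuous, fun x => ?_, fun x => ?_⟩
  · obtain ⟨p, rfl⟩ := K.surjective x
    simp only [K.symm_apply_apply, ← hΦ]
    exact initial_appendEquiv m (Φ p)
  · obtain ⟨p, rfl⟩ := K.surjective x
    obtain ⟨a, rfl⟩ := S.surjective p
    simpa [hS, hT] using a.1.2

end Cantor

/-! ### Eventual periodicity of walks -/

/-- Pigeonhole in the finite set of self-maps of `V`. -/
theorem exists_iterate_add_eq {V : Type*} [Finite V] (f : V → V) :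
    ∃ N q, 0 < q ∧ ∀ n ≥ N, ∀ k, f^[n + k * q] = f^[n] := by
  obtain ⟨i, j, hij, h⟩ := Finite.exists_ne_map_eq_of_infinite fun n : ℕ => f^[n]
  wlog hlt : i < j generalizing i j
  · exact this j i hij.symm h.symm (lt_of_le_of_ne (not_lt.1 hlt) hij.symm)
  have hstep (n : ℕ) (hn : i ≤ n) : f^[n + (j - i)] = f^[n] := by
    rw [show n + (j - i) = (n - i) + j by omega, Function.iterate_add, ← h, ← Function.iterate_add,
      Nat.sub_add_cancel hn]
  refine ⟨i, j - i, by omega, fun n hn k => ?_⟩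
  induction k with
  | zero => simp
  | succ k ih => rw [Nat.succ_mul, ← add_assoc, hstep _ (by omega), ih]

/-- The digraph on two copies of `V` in which one leaves the first copy along a section `p` of
predecessors and moves in the second copy along a section `s` of successors. -/
def TwoPhase {V : Type*} (s p : V → V) (a b : V × Bool) : Prop :=
  (b.1 = s a.1 ∧ b.2 = true) ∨ (a.1 = p b.1 ∧ a.2 = false)

/-- The copy `true` is absorbing, and a walk there is an orbit of `s`. A walk that stays in `false`
is a backward orbit of `p`, hence periodic from the start. -/
theorem TwoPhase.eventually_periodic {V : Type*} [Finite V] (s p : V → V) :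
    ∃ q, 0 < q ∧ ∀ w : ℕ → V × Bool, (∀ n, TwoPhase s p (w n) (w (n + 1))) →
      ∀ᶠ n in atTop, w (n + q) = w n := by
  obtain ⟨N, q, hq, hs⟩ := exists_iterate_add_eq s
  obtain ⟨N', q', hq', hp⟩ := exists_iterate_add_eq p
  refine ⟨q * q', Nat.mul_pos hq hq', fun w hw => ?_⟩
  by_cases h : ∃ n, (w n).2 = true
  · obtain ⟨n₀, h₀⟩ := h
    have key (k : ℕ) : w (n₀ + k) = (s^[k] (w n₀).1, true) := by
      induction k with
      | zero => exact Prod.ext rfl h₀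
      | succ k ih =>
        rw [Function.iterate_succ_apply']
        rcases hw (n₀ + k) with h | h
        · rw [ih] at h
          exact Prod.ext h.1 h.2
        · rw [ih] at h
          simp at h
    filter_upwards [eventually_ge_atTop (n₀ + N)] with n hn
    obtain ⟨k, rfl⟩ := Nat.exists_eq_add_of_le (show n₀ ≤ n by omega)
    rw [add_assoc, key, key, mul_comm, hs k (by omega)]
  · push Not at h
    have hb (n : ℕ) : (w n).2 = false := by simpa using h n
    have key (n k : ℕ) : (w n).1 = p^[k] (w (n + k)).1 := by
      induction k with
      | zero => rfl
      | succ k ih =>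
        rw [ih, Function.iterate_succ_apply]
        rcases hw (n + k) with h | h
        · have := hb (n + k + 1)
          simp [h.2] at this
        · rw [h.1, add_assoc]
    refine Eventually.of_forall fun n => Prod.ext ?_ ((hb _).trans (hb _).symm)
    -- Both vertices are images of one later vertex, under `p^[N']` and `p^[N' + q * q']`, which
    -- coincide.
    rw [key (n + q * q') N', key n (N' + q * q'), hp N' le_rfl q,
      show n + (N' + q * q') = n + q * q' + N' by omega]


open Cantor

/-! ### Generic homeomorphisms have eventually periodic itineraries -/

/-- The homeomorphisms for which the sequence of the first `m` terms of the iterates of a point is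
eventually periodic, with a period that does not depend on the point. -/
def PeriodicItineraries (m : ℕ) : Set (Cantor ≃ₜ Cantor) :=
  {h | ∃ q, 0 < q ∧ ∀ x, ∀ᶠ n in atTop, initial m (h^[n + q] x) = initial m (h^[n] x)}

/-- The fibres of `κ` are clopen and compact, so this is a finite intersection of basic sets of the
compact-open topology. -/
theorem isOpen_setOf_transitions {M D : Type*} [MetricSpace M] [CompactSpace M] [Finite D]
    [TopologicalSpace D] [DiscreteTopology D] {κ : M → D} (hκ : Continuous κ) (R : D → D → Prop) :
    IsOpen {h : M ≃ₜ M | ∀ x, R (κ x) (κ (h x))} := by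
  have he : {h : M ≃ₜ M | ∀ x, R (κ x) (κ (h x))} =
      ⋂ d, (fun h : M ≃ₜ M => (h : C(M, M))) ⁻¹'
        {f : C(M, M) | Set.MapsTo f (κ ⁻¹' {d}) (κ ⁻¹' {d' | R d d'})} := by
    ext h
    simp only [Set.mem_ofPred_eq, Set.mem_iInter, Set.mem_preimage]
    exact ⟨fun H d x hx => by rw [← show κ x = d from hx]; exact H x, fun H x => H (κ x) rfl⟩
  rw [he]
  exact isOpen_iInter_of_finite fun d => (ContinuousMap.isOpen_setOfPred_mapsTo
    ((isClosed_discrete {d}).preimage hκ).isCompact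
    ((isOpen_discrete {d' | R d d'}).preimage hκ)).preimage continuous_coe_homeo

theorem dense_interior_periodicItineraries (m : ℕ) : Dense (interior (PeriodicItineraries m)) := by
  rw [Metric.dense_iff]
  intro h ε hε
  obtain ⟨δ, hδ, huc⟩ := Metric.uniformContinuous_iff.1
    (CompactSpace.uniformContinuous_of_continuous h.continuous) (ε / 4) (by positivity)
  obtain ⟨k₀, hk₀⟩ := exists_nat_one_div_lt (lt_min hδ (show 0 < ε / 4 by positivity))
  -- Words of length `k + 1` determine the first `m` terms, and their cylinders are small both for
  -- `ε` and for the modulus of continuity of `h`.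
  obtain ⟨k, hmk, hk⟩ : ∃ k, m ≤ k ∧ 1 / ((k : ℝ) + 1) < min δ (ε / 4) :=
    ⟨max m k₀, le_max_left _ _, (one_div_le_one_div_of_le (by positivity)
      (by gcongr; exact le_max_right _ _)).trans_lt hk₀⟩
  have hclose {x y : Cantor} (hxy : initial (k + 1) x = initial (k + 1) y) :
      dist x y < min δ (ε / 4) := (initial_succ_eq_iff.1 hxy).trans hk
  have hsurj : Function.Surjective (initial (k + 1)) := fun v =>
    ⟨appendEquiv _ (v, Classical.arbitrary _), initial_appendEquiv _ _⟩
  choose y hy using hsurj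
  let s (v : Fin (k + 1) → Bool) := initial (k + 1) (h (y v))
  let p (v : Fin (k + 1) → Bool) := initial (k + 1) (h.symm (y v))
  obtain ⟨κ, g, hκ, hπ, hg⟩ := exists_homeomorph_of_digraph
    (Prod.fst : (Fin (k + 1) → Bool) × Bool → _) Prod.fst_surjective (TwoPhase s p)
    (fun d => ⟨(s d.1, true), Or.inl ⟨rfl, rfl⟩⟩) (fun d => ⟨(p d.1, false), Or.inr ⟨rfl, rfl⟩⟩)
  refine ⟨g, ?_, mem_interior.2 ⟨_, ?_, isOpen_setOf_transitions hκ (TwoPhase s p), hg⟩⟩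
  · refine lt_of_le_of_lt ((ContinuousMap.dist_le (f := (g : C(Cantor, Cantor)))
      (g := (h : C(Cantor, Cantor))) (half_pos hε).le).2 fun x => ?_) (half_lt_self hε)
    -- Each edge of either kind is realised by an actual transition `z ↦ h z`.
    obtain ⟨z, hz, hz'⟩ : ∃ z, initial (k + 1) z = initial (k + 1) x ∧
        initial (k + 1) (h z) = initial (k + 1) (g x) := by
      rcases hg x with H | H
      · exact ⟨y (κ x).1, by rw [hy, hπ], by rw [hπ (g x), H.1]⟩
      · exact ⟨h.symm (y (κ (g x)).1), by rw [hπ x, H.1], by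
          rw [h.apply_symm_apply, hy, hπ]⟩
    have h1 : dist (h z) (h x) < ε / 4 := huc ((hclose hz).trans_le (min_le_left _ _))
    have h2 : dist (g x) (h z) < ε / 4 := (hclose hz'.symm).trans_le (min_le_right _ _)
    have h3 := dist_triangle (g x) (h z) (h x)
    change dist (g x) (h x) ≤ ε / 2
    linarith
  · intro f hf
    obtain ⟨q, hq, hw⟩ := TwoPhase.eventually_periodic s p
    refine ⟨q, hq, fun x => ?_⟩
    filter_upwards [hw (fun n => κ (f^[n] x)) fun n => by
      rw [Function.iterate_succ_apply']; exact hf _] with n hn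
    have := (hπ (f^[n + q] x)).trans ((congrArg Prod.fst hn).trans (hπ (f^[n] x)).symm)
    rw [initial_eq_iff] at this ⊢
    exact fun i hi => this i (by omega)

theorem eventually_residual_periodicItineraries :
    ∀ᶠ h in residual (Cantor ≃ₜ Cantor), ∀ m, h ∈ PeriodicItineraries m :=
  eventually_countable_forall.2 fun m => mem_of_superset
    (residual_of_dense_open isOpen_interior (dense_interior_periodicItineraries m))
    interior_subset

/-! ### The Prohorov distance on the Cantor space -/

theorem measurable_initial (m : ℕ) : Measurable (initial m) :=
  (continuous_initial m).measurable

theorem thickening_initial_preimage_subset {m : ℕ} {δ : ℝ} (hδ : δ ≤ 1 / ((m : ℝ) + 1))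
    (S : Set (Fin (m + 1) → Bool)) :
    Metric.thickening δ (initial (m + 1) ⁻¹' S) ⊆ initial (m + 1) ⁻¹' S := by
  intro x hx
  obtain ⟨y, hy, hxy⟩ := Metric.mem_thickening_iff.1 hx
  rw [Set.mem_preimage, initial_succ_eq_iff.2 (hxy.trans_le hδ)]
  exact hy

theorem measureReal_initial_le_of_dist_lt {m : ℕ} {μ ν : ProbMeas Cantor} {δ : ℝ}
    (hδ : δ ≤ 1 / ((m : ℝ) + 1)) (h : dist μ ν < δ) (S : Set (Fin (m + 1) → Bool)) :
    (μ.toMeasure : Measure Cantor).real (initial (m + 1) ⁻¹' S) ≤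
      (ν.toMeasure : Measure Cantor).real (initial (m + 1) ⁻¹' S) + δ := by
  have hδ0 : 0 ≤ δ := dist_nonneg.trans h.le
  have he : levyProkhorovEDist (μ.toMeasure : Measure Cantor) ν.toMeasure < ENNReal.ofReal δ := by
    rw [← LevyProkhorov.edist_probabilityMeasure_def, edist_dist]
    exact (ENNReal.ofReal_lt_ofReal_iff_of_nonneg dist_nonneg).2 h
  have hle := left_measure_le_of_levyProkhorovEDist_lt he
    (measurable_initial (m + 1) (Set.toFinite S).measurableSet)
  rw [ENNReal.toReal_ofReal hδ0] at hle
  replace hle := hle.trans (add_le_add_left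
    (measure_mono (thickening_initial_preimage_subset hδ S)) _)
  have := ENNReal.toReal_mono (by finiteness) hle
  rwa [ENNReal.toReal_add (by finiteness) (by finiteness), ENNReal.toReal_ofReal hδ0] at this

/-- The union of the cylinders that meet `B` lies in every `ε`-thickening of `B` with `ε > δ`. One
inequality suffices for probability measures. -/
theorem dist_le_of_forall_measureReal_initial_le {m : ℕ} {μ ν : ProbMeas Cantor} {δ : ℝ}
    (hδ : 1 / ((m : ℝ) + 1) ≤ δ)
    (h : ∀ S : Set (Fin (m + 1) → Bool),
      (μ.toMeasure : Measure Cantor).real (initial (m + 1) ⁻¹' S) ≤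
        (ν.toMeasure : Measure Cantor).real (initial (m + 1) ⁻¹' S) + δ) :
    dist μ ν ≤ δ := by
  rw [LevyProkhorov.dist_probabilityMeasure_def]
  refine levyProkhorovDist_le_of_forall_le _ _ (le_trans (by positivity) hδ) fun ε B hε _ => ?_
  let A := initial (m + 1) ⁻¹' (initial (m + 1) '' B)
  have hA : A ⊆ Metric.thickening ε B := by
    rintro x ⟨y, hy, hxy⟩
    exact Metric.mem_thickening_iff.2
      ⟨y, hy, (initial_succ_eq_iff.1 hxy.symm).trans_le (hδ.trans hε.le)⟩
  have hle : (μ.toMeasure : Measure Cantor).real A ≤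
      (ν.toMeasure : Measure Cantor).real (Metric.thickening ε B) + ε :=
    (h _).trans (add_le_add (measureReal_mono hA) hε.le)
  refine (measure_mono (Set.subset_preimage_image (initial (m + 1)) B)).trans ?_
  change (μ.toMeasure : Measure Cantor) A ≤ _
  rw [← ofReal_measureReal (μ := (μ.toMeasure : Measure Cantor)),
    ← ofReal_measureReal (μ := (ν.toMeasure : Measure Cantor)),
    ← ENNReal.ofReal_add measureReal_nonneg ((le_trans (by positivity) hδ).trans hε.le)]
  exact ENNReal.ofReal_le_ofReal hle

/-! ### Orbits of measures -/

theorem measureReal_iterate_inducedMap {M : Type*} [MetricSpace M] [CompactSpace M]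
    [MeasurableSpace M] [BorelSpace M] (f : C(M, M)) (n : ℕ) (μ : ProbMeas M)
    {A : Set M} (hA : MeasurableSet A) :
    (((inducedMap f)^[n] μ).toMeasure : Measure M).real A =
      (μ.toMeasure : Measure M).real (f^[n] ⁻¹' A) := by
  induction n generalizing A with
  | zero => rfl
  | succ n ih =>
    rw [Function.iterate_succ_apply', Function.iterate_succ', Set.preimage_comp,
      ← ih (f.continuous.measurable hA)]
    simp only [Measure.real]
    exact congrArg ENNReal.toReal (ProbabilityMeasure.map_apply' _
      f.continuous.measurable.aemeasurable hA)

theorem measureReal_le_of_inter_eq {Ω : Type*} [MeasurableSpace Ω] (μ : Measure Ω)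
    [IsFiniteMeasure μ] {A B T : Set Ω} (h : A ∩ T = B ∩ T) :
    μ.real A ≤ μ.real B + μ.real Tᶜ := by
  refine (measureReal_mono (fun x hx => ?_)).trans (measureReal_union_le B Tᶜ)
  by_cases hT : x ∈ T
  · exact Or.inl (h.subset ⟨hx, hT⟩).1
  · exact Or.inr hT

/-- The sets `T N` of points whose itinerary is periodic from time `N` on increase to the whole
space, so some complement has measure below `ε`; this one bound serves all `k` and `S`. -/
theorem exists_forall_abs_measureReal_preimage_iterate_sub_le {m q : ℕ} {h : Cantor ≃ₜ Cantor}
    (hq : ∀ x, ∀ᶠ n in atTop, initial m (h^[n + q] x) = initial m (h^[n] x))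
    (μ : Measure Cantor) [IsFiniteMeasure μ] {ε : ℝ} (hε : 0 < ε) :
    ∃ N, ∀ n ≥ N, ∀ (k : ℕ) (S : Set (Fin m → Bool)),
      |μ.real (h^[n + k * q] ⁻¹' (initial m ⁻¹' S)) - μ.real (h^[n] ⁻¹' (initial m ⁻¹' S))|
        ≤ ε := by
  let T (N : ℕ) : Set Cantor := ⋂ n ≥ N, {x | initial m (h^[n + q] x) = initial m (h^[n] x)}
  have hT {N : ℕ} {x : Cantor} :
      x ∈ T N ↔ ∀ n ≥ N, initial m (h^[n + q] x) = initial m (h^[n] x) := by simp [T]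
  have hcont (n : ℕ) : Continuous fun x => initial m (h^[n] x) :=
    (continuous_initial m).comp (h.continuous.iterate n)
  have hTm (N : ℕ) : MeasurableSet (T N) :=
    (isClosed_biInter fun n _ => isClosed_eq (hcont (n + q)) (hcont n)).measurableSet
  have hanti : Antitone fun N => (T N)ᶜ := fun N N' hN =>
    Set.compl_subset_compl.2 fun x hx => hT.2 fun n hn => hT.1 hx n (hN.trans hn)
  have hempty : ⋂ N, (T N)ᶜ = ∅ := by
    refine Set.eq_empty_of_forall_notMem fun x hx => ?_
    obtain ⟨N, hN⟩ := eventually_atTop.1 (hq x)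
    exact Set.mem_iInter.1 hx N (hT.2 hN)
  have hlim := tendsto_measure_iInter_atTop (μ := μ)
    (fun N => (hTm N).compl.nullMeasurableSet) hanti ⟨0, measure_ne_top _ _⟩
  rw [hempty, measure_empty] at hlim
  have hlim' := (ENNReal.tendsto_toReal ENNReal.zero_ne_top).comp hlim
  obtain ⟨N, hN⟩ := (hlim'.eventually_lt_const (show (0 : ENNReal).toReal < ε by simpa)).exists
  refine ⟨N, fun n hn k S => ?_⟩
  have hk : ∀ x ∈ T N, initial m (h^[n + k * q] x) = initial m (h^[n] x) := by
    intro x hx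
    induction k with
    | zero => simp
    | succ k ih => rw [Nat.succ_mul, ← add_assoc, hT.1 hx _ (by omega), ih]
  have hinter : h^[n + k * q] ⁻¹' (initial m ⁻¹' S) ∩ T N = h^[n] ⁻¹' (initial m ⁻¹' S) ∩ T N := by
    ext x
    simp only [Set.mem_inter_iff, Set.mem_preimage, and_congr_left_iff]
    intro hx
    rw [hk x hx]
  have h1 := measureReal_le_of_inter_eq μ hinter
  have h2 := measureReal_le_of_inter_eq μ hinter.symm
  have h3 : μ.real (T N)ᶜ < ε := hN
  rw [abs_le]
  constructor <;> linarith

theorem tendsto_dist_iterate_inducedMap {h : Cantor ≃ₜ Cantor}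
    (hh : ∀ m, h ∈ PeriodicItineraries m) {μ ν : ProbMeas Cantor}
    (hfreq : ∀ δ > 0, ∃ᶠ n in atTop, dist ((inducedMap (h : C(Cantor, Cantor)))^[n] μ)
      ((inducedMap (h : C(Cantor, Cantor)))^[n] ν) < δ) :
    Tendsto (fun n => dist ((inducedMap (h : C(Cantor, Cantor)))^[n] μ)
      ((inducedMap (h : C(Cantor, Cantor)))^[n] ν)) atTop (𝓝 0) := by
  set F := inducedMap (h : C(Cantor, Cantor)) with hF
  rw [Metric.tendsto_atTop]
  intro ε hε
  obtain ⟨m, hm⟩ := exists_nat_one_div_lt (half_pos hε)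
  obtain ⟨q, hq, hper⟩ := hh (m + 1)
  obtain ⟨N₁, hN₁⟩ := exists_forall_abs_measureReal_preimage_iterate_sub_le hper
    (μ.toMeasure : Measure Cantor) (show 0 < ε / 8 by positivity)
  obtain ⟨N₂, hN₂⟩ := exists_forall_abs_measureReal_preimage_iterate_sub_le hper
    (ν.toMeasure : Measure Cantor) (show 0 < ε / 8 by positivity)
  -- The first `q` iterates are handled together, so one close encounter controls a whole period.
  have huc : UniformContinuous fun (x : ProbMeas Cantor) (i : Fin q) => F^[i] x :=
    CompactSpace.uniformContinuous_of_continuous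
      (continuous_pi fun i => F.continuous.iterate i)
  have hη : 0 < min (1 / ((m : ℝ) + 1)) (ε / 8) := lt_min (by positivity) (by positivity)
  obtain ⟨δ, hδ, hclose⟩ := Metric.uniformContinuous_iff.1 huc _ hη
  obtain ⟨n₀, hn₀, hlt⟩ := frequently_atTop.1 (hfreq δ hδ) (max N₁ N₂)
  refine ⟨n₀, fun n hn => ?_⟩
  rw [Real.dist_0_eq_abs, abs_of_nonneg dist_nonneg]
  refine (dist_le_of_forall_measureReal_initial_le hm.le fun S => ?_).trans_lt (half_lt_self hε)
  obtain ⟨i, k, hi, rfl⟩ : ∃ i k, i < q ∧ n = n₀ + i + k * q := by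
    refine ⟨(n - n₀) % q, (n - n₀) / q, Nat.mod_lt _ hq, ?_⟩
    have := Nat.mod_add_div' (n - n₀) q
    omega
  have hd := (dist_pi_lt_iff hη).1 (hclose hlt) ⟨i, hi⟩
  simp only [← Function.iterate_add_apply] at hd
  rw [add_comm i n₀] at hd
  have h1 := measureReal_initial_le_of_dist_lt (min_le_left _ _) hd S
  have h2 := (abs_le.1 (hN₁ (n₀ + i) (by omega) k S)).2
  have h3 := (abs_le.1 (hN₂ (n₀ + i) (by omega) k S)).1
  have hS : MeasurableSet (initial (m + 1) ⁻¹' S) :=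
    measurable_initial (m + 1) (Set.toFinite S).measurableSet
  have h4 := min_le_right (1 / ((m : ℝ) + 1)) (ε / 8)
  rw [measureReal_iterate_inducedMap _ _ _ hS, measureReal_iterate_inducedMap _ _ _ hS] at h1 ⊢
  simp only [ContinuousMap.coe_coe] at h1 ⊢
  -- Three errors of at most `ε / 8`: one at time `n₀ + i`, and one for each measure in passing to
  -- `n`.
  linarith

theorem not_isLiYorkePair_inducedMap {h : Cantor ≃ₜ Cantor}
    (hh : ∀ m, h ∈ PeriodicItineraries m) (μ ν : ProbMeas Cantor) :
    ¬ IsLiYorkePair (inducedMap (h : C(Cantor, Cantor))) μ ν := by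
  rintro ⟨hinf, hsup⟩
  refine hsup.ne' (tendsto_dist_iterate_inducedMap hh fun δ hδ => ?_).limsup_eq
  refine frequently_lt_of_liminf_lt ?_ (hinf.trans_lt hδ)
  exact (isBoundedUnder_of ⟨Metric.diam (Set.univ : Set (ProbMeas Cantor)), fun n =>
    Metric.dist_le_diam_of_mem isCompact_univ.isBounded (Set.mem_univ _)
      (Set.mem_univ _)⟩).isCoboundedUnder_ge

end CantorDynamics

theorem theorem3p1 :
    CantorDynamics.Generic (CantorDynamics.Cantor ≃ₜ CantorDynamics.Cantor) (fun h =>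
      ¬ ∃ μ ν : CantorDynamics.ProbMeas CantorDynamics.Cantor,
        CantorDynamics.IsLiYorkePair
          (CantorDynamics.inducedMap (h : C(CantorDynamics.Cantor, CantorDynamics.Cantor))) μ ν) := by
  refine mem_of_superset CantorDynamics.eventually_residual_periodicItineraries fun h hh => ?_
  simp only [Set.mem_compl_iff, Set.mem_ofPred_eq, not_not]
  rintro ⟨μ, ν, hLY⟩
  exact CantorDynamics.not_isLiYorkePair_inducedMap hh μ ν hLY
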